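/- Let $n\ge 0$ and let $D\subseteq [n]\times[n]$ be a diagram (a set of boxes $(i,j)$, row $i$, column $j$, in matrix coordinates), with columns $D_j=\{i:(i,j)\in D\}$. For subsets $R=\{r_1<\dots<r_k\}$, $S=\{s_1<\dots<s_k\}$ of $[n]$ of the same size write $R\le S$ if $r_i\le s_i$ for all $i$, and for diagrams write $C\le D$ if $C_j\le D_j$ for all $j$. Let $Y=(y_{ij})$ be the upper-triangular matrix of variables $y_{ij}$, $1\le i\le j\le n$ (with zeros below the diagonal), and let $Y^R_S$ be its submatrix with rows $R$ and columns $S$. The flagged Weyl module of $D$ is $$\mathcal M_D=\mathrm{Span}_{\mathbb C}\Big\{\prod_{j=1}^n\det\big(Y^{C_j}_{D_j}\big): C\le D\Big\}\subseteq\mathbb C[Y],$$ on which invertible upper-triangular matrices $b$ act by $f(Y)\mapsto f(b^{-1}Y)$. Its dual character is $\chi_D(x_1,\dots,x_n)=\mathrm{tr}\big(\mathrm{diag}(x_1^{-1},\dots,x_n^{-1}):\mathcal M_D\to\mathcal M_D\big)$, and $\chi_D(1,\dots,1)$ is its principal specialization. Let $r_1(D)$, $r_2(D)$, $r_3(D)$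 be the numbers of sets $E$ of boxes of $[n]\times[n]$ of the following forms: * $r_1(D)$: $E=\{(i_1,j),(i_2,j)\}$ with $i_1<i_2$ and $E\cap D=\{(i_2,j)\}$; * $r_2(D)$: $E=\{i_1,i_2,i_3\}\times\{j_1,j_2\}$ with $i_1<i_2<i_3$, $j_1<j_2$, and $E\cap D$ equal to $\{(i_2,j_1),(i_2,j_2),(i_3,j_1)\}$ or to $\{(i_2,j_1),(i_2,j_2),(i_3,j_2)\}$; * $r_3(D)$: $E=\{(i_1,j),(i_2,j),(i_3,j'),(i_4,j')\}$ with $i_1<i_2<i_3<i_4$, $j,j'$ arbitrary (possibly equal), and $E\cap D=\{(i_2,j),(i_4,j')\}$. Then $$\chi_D(1,\dots,1)\ \ge\ 1+r_1(D)+r_2(D)+r_3(D).$$ -/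

import Mathlib

open scoped ComplexOrder

namespace FlaggedWeyl

/-- A diagram: a set of boxes `(i, j)` (row `i`, column `j`, matrix coordinates) of the
`n × n` grid. -/
abbrev Diagram (n : ℕ) : Type := Finset (Fin n × Fin n)

/-- The `j`-th column of `D`, as a set of row indices. -/
def Diagram.col {n : ℕ} (D : Diagram n) (j : Fin n) : Finset (Fin n) :=
  Finset.univ.filter fun i => (i, j) ∈ D

/-- Gale order: `R` and `S` have the same cardinality, and the `k`-th smallest element of `R`
is at most the `k`-th smallest element of `S`, for each `k`. -/
def GaleLE {n : ℕ} (R S : Finset (Fin n)) : Prop :=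
  ∃ h : R.card = S.card, ∀ k : Fin S.card, R.orderEmbOfFin h k ≤ S.orderEmbOfFin rfl k

/-- `C ≤ D` for diagrams: columnwise Gale order. -/
def Diagram.GaleLE {n : ℕ} (C D : Diagram n) : Prop :=
  ∀ j : Fin n, FlaggedWeyl.GaleLE (C.col j) (D.col j)

/-- Index set of the variables `y_{ij}`, `i ≤ j`. -/
abbrev VarIdx (n : ℕ) : Type := {p : Fin n × Fin n // p.1 ≤ p.2}

/-- The polynomial ring `ℂ[Y]` in the variables `y_{ij}`, `i ≤ j`. -/
abbrev PolyY (n : ℕ) : Type := MvPolynomial (VarIdx n) ℂ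

/-- The generic upper-triangular matrix `Y`. -/
noncomputable def matY (n : ℕ) : Matrix (Fin n) (Fin n) (PolyY n) :=
  Matrix.of fun i j => if h : i ≤ j then MvPolynomial.X ⟨(i, j), h⟩ else 0

/-- The determinant of the submatrix of `Y` with row set `R` and column set `S`. -/
noncomputable def minorY {n : ℕ} (R S : Finset (Fin n)) (h : R.card = S.card) : PolyY n :=
  ((matY n).submatrix (R.orderEmbOfFin h) (S.orderEmbOfFin rfl)).det

/-- `det(Y_D^C)`, the product over all columns `j` of `det(Y_{D_j}^{C_j})`, for `C ≤ D`. -/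
noncomputable def detY {n : ℕ} (C D : Diagram n) (h : C.GaleLE D) : PolyY n :=
  ∏ j : Fin n, minorY (C.col j) (D.col j) (h j).1

/-- The flagged Weyl module of `D`: the span of the `det(Y_D^C)`, `C ≤ D`. -/
noncomputable def flaggedWeylModule {n : ℕ} (D : Diagram n) : Submodule ℂ (PolyY n) :=
  Submodule.span ℂ {f | ∃ (C : Diagram n) (h : C.GaleLE D), f = detY C D h}

/-- The action `f(Y) ↦ f(b⁻¹ Y)` of an (upper-triangular) invertible matrix `b` on `ℂ[Y]`:
substitute for `y_{ij}`, `i ≤ j`, the `(i, j)` entry of `b⁻¹ Y`. -/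
noncomputable def act {n : ℕ} (b : GL (Fin n) ℂ) : PolyY n →ₐ[ℂ] PolyY n :=
  MvPolynomial.aeval fun p : VarIdx n =>
    (((b⁻¹ : GL (Fin n) ℂ) : Matrix (Fin n) (Fin n) ℂ).map
      (MvPolynomial.C : ℂ →+* PolyY n) * matY n : Matrix (Fin n) (Fin n) (PolyY n))
        p.1.1 p.1.2

/-- The diagonal matrix `diag(x_1, …, x_n)`. -/
def diagGL {n : ℕ} (x : Fin n → ℂˣ) : GL (Fin n) ℂ where
  val := Matrix.diagonal fun i => (x i : ℂ)
  inv := Matrix.diagonal fun i => ((x i)⁻¹ : ℂˣ)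
  val_inv := by simp [Matrix.diagonal_mul_diagonal]
  inv_val := by simp [Matrix.diagonal_mul_diagonal]

theorem act_diagGL_matY {n : ℕ} (x : Fin n → ℂˣ) (i j : Fin n) :
    act (diagGL x) (matY n i j) = MvPolynomial.C (((x i)⁻¹ : ℂˣ) : ℂ) * matY n i j := by
  by_cases h : i ≤ j
  · have hinv : (((diagGL x)⁻¹ : GL (Fin n) ℂ) : Matrix (Fin n) (Fin n) ℂ)
        = Matrix.diagonal fun i => (((x i)⁻¹ : ℂˣ) : ℂ) := rfl
    have h1 : matY n i j = MvPolynomial.X ⟨(i, j), h⟩ := by simp [matY, h]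
    conv_lhs => rw [h1]
    rw [act, MvPolynomial.aeval_X, hinv, Matrix.diagonal_map (map_zero _),
      Matrix.diagonal_mul]
  · simp [matY, h]

/-- `det(Y_D^C)` is an eigenvector of every diagonal matrix. -/
theorem act_diagGL_detY {n : ℕ} (x : Fin n → ℂˣ) (C D : Diagram n) (h : C.GaleLE D) :
    act (diagGL x) (detY C D h)
      = (∏ j : Fin n, ∏ i ∈ C.col j, (((x i)⁻¹ : ℂˣ) : ℂ)) • detY C D h := by
  have key : ∀ (R S : Finset (Fin n)) (hc : R.card = S.card),
      act (diagGL x) (minorY R S hc)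
        = MvPolynomial.C (∏ i ∈ R, (((x i)⁻¹ : ℂˣ) : ℂ)) * minorY R S hc := by
    intro R S hc
    have hm : (act (diagGL x)).mapMatrix
          ((matY n).submatrix (R.orderEmbOfFin hc) (S.orderEmbOfFin rfl))
        = Matrix.of fun k l =>
          MvPolynomial.C (((x (R.orderEmbOfFin hc k))⁻¹ : ℂˣ) : ℂ) *
            ((matY n).submatrix (R.orderEmbOfFin hc) (S.orderEmbOfFin rfl)) k l := by
      ext1 k l
      exact act_diagGL_matY x _ _
    rw [minorY, AlgHom.map_det, hm, Matrix.det_mul_column, map_prod]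
    congr 1
    rw [← map_prod, ← map_prod]
    congr 1
    conv_rhs => rw [← Finset.image_orderEmbOfFin_univ R hc]
    rw [Finset.prod_image fun a _ b _ hab => (R.orderEmbOfFin hc).injective hab]
  rw [detY, map_prod, Finset.prod_congr rfl fun j _ => key _ _ _, Finset.prod_mul_distrib,
    ← map_prod, MvPolynomial.smul_eq_C_mul]

/-- The flagged Weyl module is stable under diagonal matrices. -/
theorem act_diagGL_mem {n : ℕ} (D : Diagram n) (x : Fin n → ℂˣ) :
    ∀ f ∈ flaggedWeylModule D, (act (diagGL x)).toLinearMap f ∈ flaggedWeylModule D := by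
  intro f hf
  refine Submodule.span_induction (p := fun f _ =>
    (act (diagGL x)).toLinearMap f ∈ flaggedWeylModule D) ?_ ?_ ?_ ?_ hf
  · rintro _ ⟨C, h, rfl⟩
    rw [AlgHom.toLinearMap_apply, act_diagGL_detY]
    exact Submodule.smul_mem _ _ (Submodule.subset_span ⟨C, h, rfl⟩)
  · simp
  · intro f g _ _ hf hg
    rw [map_add]
    exact Submodule.add_mem _ hf hg
  · intro c f _ hf
    rw [map_smul]
    exact Submodule.smul_mem _ _ hf

/-- The character of the flagged Weyl module: the trace of `diag(x_1, …, x_n)` on it. -/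
noncomputable def character {n : ℕ} (D : Diagram n) (x : Fin n → ℂˣ) : ℂ :=
  LinearMap.trace ℂ (flaggedWeylModule D)
    ((act (diagGL x)).toLinearMap.restrict (act_diagGL_mem D x))

/-- The dual character `χ_D(x_1, …, x_n)`: the character at `(x_1⁻¹, …, x_n⁻¹)`. -/
noncomputable def dualCharacter {n : ℕ} (D : Diagram n) (x : Fin n → ℂˣ) : ℂ :=
  character D fun i => (x i)⁻¹

/-! A subdiagram equal to a configuration is a set `E` of boxes in the relative position shown
by the configuration, such that the boxes of `E` that belong to `D` are exactly the shaded ones.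
In the pictures, `#` is a shaded box (in `D`), `o` is a blank box (not in `D`), and `.` is a
position which is not part of the configuration. -/

/-- Configuration (A), rows `o / #`. -/
def IsConfigA {n : ℕ} (D E : Diagram n) : Prop :=
  ∃ i₁ i₂ j : Fin n, i₁ < i₂ ∧
    E = {(i₁, j), (i₂, j)} ∧ E ∩ D = {(i₂, j)}

/-- Configuration (B), rows `o o / # # / # o`. -/
def IsConfigB {n : ℕ} (D E : Diagram n) : Prop :=
  ∃ i₁ i₂ i₃ j₁ j₂ : Fin n, i₁ < i₂ ∧ i₂ < i₃ ∧ j₁ < j₂ ∧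
    E = {(i₁, j₁), (i₁, j₂), (i₂, j₁), (i₂, j₂), (i₃, j₁), (i₃, j₂)} ∧
    E ∩ D = {(i₂, j₁), (i₂, j₂), (i₃, j₁)}

/-- Configuration (B'), rows `o o / # # / o #`. -/
def IsConfigB' {n : ℕ} (D E : Diagram n) : Prop :=
  ∃ i₁ i₂ i₃ j₁ j₂ : Fin n, i₁ < i₂ ∧ i₂ < i₃ ∧ j₁ < j₂ ∧
    E = {(i₁, j₁), (i₁, j₂), (i₂, j₁), (i₂, j₂), (i₃, j₁), (i₃, j₂)} ∧
    E ∩ D = {(i₂, j₁), (i₂, j₂), (i₃, j₂)}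

/-- Configuration (C), rows `o . / # . / . o / . #`. -/
def IsConfigC {n : ℕ} (D E : Diagram n) : Prop :=
  ∃ i₁ i₂ i₃ i₄ j₁ j₂ : Fin n, i₁ < i₂ ∧ i₂ < i₃ ∧ i₃ < i₄ ∧ j₁ < j₂ ∧
    E = {(i₁, j₁), (i₂, j₁), (i₃, j₂), (i₄, j₂)} ∧ E ∩ D = {(i₂, j₁), (i₄, j₂)}

/-- Configuration (C'), rows `. o / . # / o . / # .`. -/
def IsConfigC' {n : ℕ} (D E : Diagram n) : Prop :=
  ∃ i₁ i₂ i₃ i₄ j₁ j₂ : Fin n, i₁ < i₂ ∧ i₂ < i₃ ∧ i₃ < i₄ ∧ j₁ < j₂ ∧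
    E = {(i₁, j₂), (i₂, j₂), (i₃, j₁), (i₄, j₁)} ∧ E ∩ D = {(i₂, j₂), (i₄, j₁)}

/-- Configuration (C''), rows `o / # / o / #`. -/
def IsConfigC'' {n : ℕ} (D E : Diagram n) : Prop :=
  ∃ i₁ i₂ i₃ i₄ j : Fin n, i₁ < i₂ ∧ i₂ < i₃ ∧ i₃ < i₄ ∧
    E = {(i₁, j), (i₂, j), (i₃, j), (i₄, j)} ∧ E ∩ D = {(i₂, j), (i₄, j)}

/-- The number of subdiagrams of `D` equal to (A). -/
noncomputable def r₁ {n : ℕ} (D : Diagram n) : ℕ :=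
  {E : Diagram n | IsConfigA D E}.ncard

/-- The number of subdiagrams of `D` equal to (B) or (B'). -/
noncomputable def r₂ {n : ℕ} (D : Diagram n) : ℕ :=
  {E : Diagram n | IsConfigB D E ∨ IsConfigB' D E}.ncard

/-- The number of subdiagrams of `D` equal to (C), (C') or (C''). -/
noncomputable def r₃ {n : ℕ} (D : Diagram n) : ℕ :=
  {E : Diagram n | IsConfigC D E ∨ IsConfigC' D E ∨ IsConfigC'' D E}.ncard

end FlaggedWeyl

/-! At x = (1, …, 1) the acting matrix is the identity, so the trace is the dimension of the module
(`dualCharacter_one`). It remains to find 1 + r₁ + r₂ + r₃ linearly independent elements.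

Put 1 on the diagonal of Y and multiply the off-diagonal variables by t. If the part of lowest
t-degree of each of several polynomials is a single monomial, and these monomials are distinct, the
polynomials are independent (`linearIndependent_of_hasInitial`). Suppose C arises from D by moving
some boxes up into empty positions of their columns, moved boxes not jumping over each other. Then,
up to sign, det(Y_D^C) has as initial monomial the product of y_{pq} over all moves q → p
(`IsMove.hasInitial_det`, `exists_mem_hasInitial`).

A configuration is encoded by multiplicities: a column that is the a-th one admitting a given move
is recorded by performing that move in the first a such columns, which yields y_{pq}^a. Type (A)
gives y_{pq}^a, type (B) gives y_{pr}^a y_{pq}^b, type (C) gives y_{pq}^a y_{rs}^b; the empty move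
gives 1. The variables and exponents recover the rows and columns, so all these monomials are
distinct. -/

namespace FlaggedWeyl

/-! ### Initial monomials and linear independence -/

/-- The ring containing the rescaled generic matrix: polynomials in a parameter `t` with
coefficients in the polynomial ring in variables indexed by all positions. -/
abbrev ScaledPoly (n : ℕ) : Type := Polynomial (MvPolynomial (Fin n × Fin n) ℂ)

/-- The substitution `y_{ii} ↦ 1`, `y_{ij} ↦ t y_{ij}` for `i < j`. -/
noncomputable def scaleOffDiag (n : ℕ) : PolyY n →ₐ[ℂ] ScaledPoly n :=
  MvPolynomial.aeval fun p : VarIdx n =>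
    if p.1.1 = p.1.2 then 1 else Polynomial.X * Polynomial.C (MvPolynomial.X p.1)

theorem scaleOffDiag_matY_self {n : ℕ} (i : Fin n) : scaleOffDiag n (matY n i i) = 1 := by
  simp [scaleOffDiag, matY]

theorem scaleOffDiag_matY_of_ne {n : ℕ} {i j : Fin n} (h : i ≠ j) :
    scaleOffDiag n (matY n i j) =
      Polynomial.X * Polynomial.C (if i ≤ j then MvPolynomial.X (i, j) else 0) := by
  by_cases hij : i ≤ j <;> simp [scaleOffDiag, matY, hij, h]

/-- `f` has initial monomial `m` if, after rescaling the off-diagonal variables by `t`, its part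
of lowest degree in `t` is the monomial `m`. -/
def HasInitial {n : ℕ} (f : PolyY n) (m : Fin n × Fin n →₀ ℕ) : Prop :=
  ∃ g : ScaledPoly n, scaleOffDiag n f =
    Polynomial.X ^ m.degree * (Polynomial.C (MvPolynomial.monomial m 1) + Polynomial.X * g)

theorem hasInitial_one {n : ℕ} : HasInitial (1 : PolyY n) 0 :=
  ⟨0, by simp⟩

theorem HasInitial.mul {n : ℕ} {f f' : PolyY n} {m m' : Fin n × Fin n →₀ ℕ}
    (h : HasInitial f m) (h' : HasInitial f' m') : HasInitial (f * f') (m + m') := by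
  obtain ⟨g, hg⟩ := h
  obtain ⟨g', hg'⟩ := h'
  refine ⟨Polynomial.C (MvPolynomial.monomial m 1) * g' + g * Polynomial.C
    (MvPolynomial.monomial m' 1) + Polynomial.X * g * g', ?_⟩
  have : MvPolynomial.monomial (m + m') (1 : ℂ) =
      MvPolynomial.monomial m 1 * MvPolynomial.monomial m' 1 := by
    rw [MvPolynomial.monomial_mul, one_mul]
  rw [map_mul, hg, hg', this, map_add, pow_add, map_mul]
  ring

theorem HasInitial.prod {n : ℕ} {ι : Type*} (s : Finset ι) {f : ι → PolyY n}
    {m : ι → Fin n × Fin n →₀ ℕ} (h : ∀ i ∈ s, HasInitial (f i) (m i)) :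
    HasInitial (∏ i ∈ s, f i) (∑ i ∈ s, m i) := by
  classical
  induction s using Finset.induction_on with
  | empty => simpa using hasInitial_one
  | insert a s ha ih =>
    rw [Finset.prod_insert ha, Finset.sum_insert ha]
    exact (h a (by simp)).mul (ih fun i hi => h i (by simp [hi]))

/-- Polynomials with distinct initial monomials are linearly independent. -/
theorem linearIndependent_of_hasInitial {n : ℕ} (K : Finset (Fin n × Fin n →₀ ℕ))
    (f : K → PolyY n) (hf : ∀ m : K, HasInitial (f m) m) : LinearIndependent ℂ f := by
  rw [Fintype.linearIndependent_iff]
  intro a ha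
  choose g hg using hf
  -- Compare coefficients of `t ^ d` times the monomial `m₀`: terms of smaller degree vanish by
  -- induction, terms of larger degree start at a higher power of `t`, and the others of degree `d`
  -- contribute a different monomial.
  have key : ∀ d : ℕ, ∀ m : K, m.1.degree = d → a m = 0 := by
    intro d
    induction d using Nat.strong_induction_on with
    | _ d ih =>
    intro m₀ hm₀
    have h0 := congrArg (fun q => MvPolynomial.coeff m₀.1 ((scaleOffDiag n q).coeff d)) ha
    simp only [map_sum, map_smul, map_zero, Polynomial.finsetSum_coeff, Polynomial.coeff_smul,
      MvPolynomial.coeff_sum, MvPolynomial.coeff_smul, Polynomial.coeff_zero,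
      MvPolynomial.coeff_zero, smul_eq_mul] at h0
    rw [Finset.sum_eq_single m₀] at h0
    · rw [hg, ← hm₀, Polynomial.coeff_X_pow_mul'] at h0
      simpa using h0
    · intro m _ hm
      rcases lt_trichotomy m.1.degree d with h | h | h
      · rw [ih _ h m rfl, zero_mul]
      · rw [hg, ← h, Polynomial.coeff_X_pow_mul']
        have : m.1 ≠ m₀.1 := fun h => hm (Subtype.ext h)
        simp [MvPolynomial.coeff_monomial, this]
      · rw [hg, Polynomial.coeff_X_pow_mul', if_neg (by omega)]
        simp
    · simp
  exact fun m => key _ m rfl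

/-! ### Moves within one column and their minors -/

/-- A map moving elements of `S` to smaller positions outside `S`, such that moved elements do
not jump over each other. -/
structure IsMove {n : ℕ} (S : Finset (Fin n)) (g : Fin n → Fin n) : Prop where
  le : ∀ d, g d ≤ d
  notMem : ∀ d ∈ S, g d ≠ d → g d ∉ S
  lt : ∀ d ∈ S, ∀ d' ∈ S, d < d' → g d ≠ d → g d' ≠ d' → d < g d'

theorem IsMove.injOn {n : ℕ} {S : Finset (Fin n)} {g : Fin n → Fin n} (hg : IsMove S g) :
    Set.InjOn g S := by
  have key : ∀ d ∈ S, ∀ d' ∈ S, d < d' → g d ≠ g d' := by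
    intro d hd d' hd' hlt heq
    by_cases h : g d = d
    · by_cases h' : g d' = d'
      · exact hlt.ne (by rw [← h, heq, h'])
      · exact hg.notMem d' hd' h' (by rwa [← heq, h])
    · by_cases h' : g d' = d'
      · exact hg.notMem d hd h (by rwa [heq, h'])
      · exact absurd (hg.lt d hd d' hd' hlt h h') (by rw [← heq]; exact (hg.le d).not_gt)
  intro d hd d' hd' heq
  rcases lt_trichotomy d d' with h | h | h
  · exact absurd heq (key d hd d' hd' h)
  · exact h
  · exact absurd heq.symm (key d' hd' d hd h)

/-- Two enumerations of the image of `S` under an injective map differ by a permutation. -/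
theorem exists_perm_orderEmbOfFin {n : ℕ} {S : Finset (Fin n)} {g : Fin n → Fin n}
    (hg : Set.InjOn g S) (h : (S.image g).card = S.card) :
    ∃ σ : Equiv.Perm (Fin S.card), ∀ k,
      (S.image g).orderEmbOfFin h (σ k) = g (S.orderEmbOfFin rfl k) := by
  have hex : ∀ k, ∃ l, (S.image g).orderEmbOfFin h l = g (S.orderEmbOfFin rfl k) := by
    intro k
    have : g (S.orderEmbOfFin rfl k) ∈ Set.range ((S.image g).orderEmbOfFin h) := by
      rw [Finset.range_orderEmbOfFin]
      exact_mod_cast Finset.mem_image_of_mem g (Finset.orderEmbOfFin_mem _ _ _)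
    exact this
  choose σ hσ using hex
  have hinj : Function.Injective σ := by
    intro k l hkl
    have := hσ k
    rw [hkl, hσ l] at this
    exact ((S.orderEmbOfFin rfl).injective (hg (Finset.orderEmbOfFin_mem _ _ _)
      (Finset.orderEmbOfFin_mem _ _ _) this)).symm
  exact ⟨Equiv.ofBijective σ (Finite.injective_iff_bijective.mp hinj), hσ⟩

theorem galeLE_image {n : ℕ} {S : Finset (Fin n)} {g : Fin n → Fin n}
    (hg : Set.InjOn g S) (hle : ∀ d, g d ≤ d) : GaleLE (S.image g) S := by
  refine ⟨Finset.card_image_of_injOn hg, fun k => ?_⟩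
  obtain ⟨σ, hσ⟩ := exists_perm_orderEmbOfFin hg (Finset.card_image_of_injOn hg)
  by_contra! hlt
  -- Pigeonhole: the `k + 1` smallest elements of `S` would all be sent strictly below the image
  -- element of index `k`, where only `k` image elements lie.
  have hmaps : ∀ i ∈ Finset.Iic k, σ i ∈ Finset.Iio k := by
    intro i hi
    rw [Finset.mem_Iic] at hi
    rw [Finset.mem_Iio, ← (Finset.orderEmbOfFin _ (Finset.card_image_of_injOn hg)).lt_iff_lt, hσ]
    exact (hle _).trans_lt ((((S.orderEmbOfFin rfl).le_iff_le).mpr hi).trans_lt hlt)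
  have := Finset.card_le_card_of_injOn σ hmaps σ.injective.injOn
  simp at this

/-- The exponent recording which elements of `S` are moved by `g`, and where to. -/
noncomputable def moveExponent {n : ℕ} (S : Finset (Fin n)) (g : Fin n → Fin n) :
    Fin n × Fin n →₀ ℕ :=
  ∑ d ∈ S, if g d = d then 0 else Finsupp.single (g d, d) 1

/-- A matrix which is diagonal outside a set of rows on which it is triangular has the product of
its diagonal entries as determinant. -/
theorem det_eq_prod_diag {m : ℕ} {R : Type*} [CommRing R] (N : Matrix (Fin m) (Fin m) R)
    (p : Fin m → Prop) (h₁ : ∀ k l, ¬ p k → k ≠ l → N k l = 0)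
    (h₂ : ∀ k l, p k → p l → l < k → N k l = 0) : N.det = ∏ k, N k k := by
  -- After transposing, the Leibniz products read `∏ k, N k (σ k)`, with one factor per row.
  rw [← Matrix.det_transpose, Matrix.det_apply, Finset.sum_eq_single 1]
  · simp
  · intro σ _ hσ
    by_cases hp : ∀ k, σ k ≠ k → p k
    · have : ∃ k, σ k < k := by
        by_contra! hle
        apply hσ
        ext1 k
        -- A permutation with `k ≤ σ k` throughout is the identity, because both sides have the same
        -- sum.
        have hs : ∑ k : Fin m, (k : ℕ) = ∑ k, (σ k : ℕ) :=
          (Equiv.sum_comp σ fun k => (k : ℕ)).symm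
        have := (Finset.sum_eq_sum_iff_of_le (f := fun k : Fin m => (k : ℕ))
          (g := fun k => (σ k : ℕ)) fun k _ => hle k).mp hs k (Finset.mem_univ k)
        exact (Fin.ext this).symm
      obtain ⟨k, hk⟩ := this
      rw [Finset.prod_eq_zero (Finset.mem_univ k), smul_zero]
      exact h₂ _ _ (hp k hk.ne) (hp _ fun h => hk.ne (σ.injective h)) hk
    · push Not at hp
      obtain ⟨k, hk, hpk⟩ := hp
      rw [Finset.prod_eq_zero (Finset.mem_univ k), smul_zero]
      exact h₁ _ _ hpk hk.symm
  · simp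

/-- A moved row has its index outside `S`, so all its entries are off-diagonal and one factor `t`
comes out. At `t = 0` the unmoved rows become unit vectors, while the no-jump condition makes the
moved rows triangular; only the diagonal product survives. -/
theorem IsMove.hasInitial_det {n : ℕ} {S : Finset (Fin n)} {g : Fin n → Fin n}
    (hg : IsMove S g) :
    HasInitial ((matY n).submatrix (fun k => g (S.orderEmbOfFin rfl k))
      (S.orderEmbOfFin rfl)).det (moveExponent S g) := by
  set e := S.orderEmbOfFin rfl with he
  have hmem : ∀ k, e k ∈ S := fun k => Finset.orderEmbOfFin_mem _ _ _
  have hsum : moveExponent S g =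
      ∑ k, if g (e k) = e k then 0 else Finsupp.single (g (e k), e k) 1 := by
    rw [moveExponent]
    conv_lhs => rw [← Finset.image_orderEmbOfFin_univ S rfl]
    rw [Finset.sum_image fun a _ b _ hab => (S.orderEmbOfFin rfl).injective hab]
  -- The rescaled matrix with the factor `t` removed from each moved row.
  let N : Matrix (Fin S.card) (Fin S.card) (ScaledPoly n) := Matrix.of fun k l =>
    if g (e k) = e k then scaleOffDiag n (matY n (e k) (e l))
    else Polynomial.C (if g (e k) ≤ e l then MvPolynomial.X (g (e k), e l) else 0)
  have hdet : scaleOffDiag n ((matY n).submatrix (fun k => g (e k)) e).det =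
      Polynomial.X ^ (moveExponent S g).degree * N.det := by
    have hv : (Polynomial.X : ScaledPoly n) ^ (moveExponent S g).degree =
        ∏ k, if g (e k) = e k then 1 else Polynomial.X := by
      rw [hsum, map_sum, ← Finset.prod_pow_eq_pow_sum]
      refine Finset.prod_congr rfl fun k _ => ?_
      split_ifs <;> simp
    rw [AlgHom.map_det, hv, ← Matrix.det_mul_column]
    congr 1
    ext1 k l
    by_cases h : g (e k) = e k
    · simp [N, h]
    · have hne : g (e k) ≠ e l := fun h' => hg.notMem _ (hmem k) h (h' ▸ hmem l)
      simp [N, h, scaleOffDiag_matY_of_ne hne]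
  have hzero : N.det.coeff 0 = MvPolynomial.monomial (moveExponent S g) 1 := by
    rw [← Polynomial.constantCoeff_apply, RingHom.map_det, det_eq_prod_diag _
      (fun k => g (e k) ≠ e k)]
    · rw [hsum, MvPolynomial.monomial_sum_one]
      refine Finset.prod_congr rfl fun k _ => ?_
      by_cases h : g (e k) = e k
      · simp [N, h, scaleOffDiag_matY_self]
      · simp [N, h, hg.le, MvPolynomial.X]
    · intro k l hk hkl
      have hne : e k ≠ e l := fun h => hkl (e.injective h)
      simp only [not_not] at hk
      simp [N, hk, scaleOffDiag_matY_of_ne hne]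
    · intro k l hk hl hlk
      have := hg.lt _ (hmem l) _ (hmem k) (e.strictMono hlk) hl hk
      simp [N, hk, this.not_ge]
  refine ⟨N.det.divX, ?_⟩
  rw [hdet, ← hzero, add_comm, Polynomial.X_mul_divX_add]

/-- The minor attached to a move is, up to sign, the determinant with rows in the order given by
the move. -/
theorem exists_det_eq_smul_minorY {n : ℕ} {S R : Finset (Fin n)} {g : Fin n → Fin n}
    (hg : Set.InjOn g S) (hR : R = S.image g) (h : R.card = S.card) :
    ∃ c : ℂ, ((matY n).submatrix (fun k => g (S.orderEmbOfFin rfl k))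
      (S.orderEmbOfFin rfl)).det = c • minorY R S h := by
  subst hR
  obtain ⟨σ, hσ⟩ := exists_perm_orderEmbOfFin hg h
  refine ⟨((Equiv.Perm.sign σ : ℤ) : ℂ), ?_⟩
  have : (matY n).submatrix (fun k => g (S.orderEmbOfFin rfl k)) (S.orderEmbOfFin rfl) =
      ((matY n).submatrix ((S.image g).orderEmbOfFin h) (S.orderEmbOfFin rfl)).submatrix σ id := by
    ext1 k l
    simp [hσ]
  rw [this, Matrix.det_permute, minorY, MvPolynomial.smul_eq_C_mul]
  simp

/-! ### Elements of the module, and its dimension -/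

/-- Moving every column of `D` produces an element of the flagged Weyl module with the
corresponding initial monomial. -/
theorem exists_mem_hasInitial {n : ℕ} (D : Diagram n) (G : Fin n → Fin n → Fin n)
    (hG : ∀ j, IsMove (D.col j) (G j)) :
    ∃ f ∈ flaggedWeylModule D, HasInitial f (∑ j, moveExponent (D.col j) (G j)) := by
  let C : Diagram n := Finset.univ.filter fun x => x.1 ∈ (D.col x.2).image (G x.2)
  have hC : ∀ j, C.col j = (D.col j).image (G j) := by
    intro j
    ext i
    simp [C, Diagram.col]
  have hle : C.GaleLE D := fun j => by
    rw [hC]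
    exact galeLE_image (hG j).injOn (hG j).le
  choose c hc using fun j => exists_det_eq_smul_minorY (hG j).injOn (hC j) (hle j).1
  refine ⟨∏ j, _, ?_, HasInitial.prod _ fun j _ => (hG j).hasInitial_det⟩
  simp only [hc]
  rw [Finset.prod_smul]
  exact Submodule.smul_mem _ _ (Submodule.subset_span ⟨C, hle, rfl⟩)

instance finite_flaggedWeylModule {n : ℕ} (D : Diagram n) :
    Module.Finite ℂ (flaggedWeylModule D) := by
  have : {f | ∃ (C : Diagram n) (h : C.GaleLE D), f = detY C D h}.Finite := by
    refine (Set.finite_range fun C : {C : Diagram n // C.GaleLE D} => detY C.1 D C.2).subset ?_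
    rintro _ ⟨C, h, rfl⟩
    exact ⟨⟨C, h⟩, rfl⟩
  exact Module.Finite.span_of_finite ℂ this

/-- The principal specialization of the dual character is the dimension of the module. -/
theorem dualCharacter_one {n : ℕ} (D : Diagram n) :
    dualCharacter D 1 = Module.finrank ℂ (flaggedWeylModule D) := by
  have hact : act (diagGL fun i : Fin n => ((1 : Fin n → ℂˣ) i)⁻¹) = AlgHom.id ℂ (PolyY n) := by
    refine MvPolynomial.algHom_ext fun p => ?_
    have := act_diagGL_matY (fun i : Fin n => ((1 : Fin n → ℂˣ) i)⁻¹) p.1.1 p.1.2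
    simpa [matY, p.2] using this
  rw [dualCharacter, character, ← LinearMap.trace_id]
  congr 1
  ext1 f
  apply Subtype.ext
  rw [LinearMap.coe_restrict_apply, hact]
  rfl

theorem card_le_finrank {n : ℕ} (D : Diagram n) (K : Finset (Fin n × Fin n →₀ ℕ))
    (hK : ∀ m ∈ K, ∃ f ∈ flaggedWeylModule D, HasInitial f m) :
    K.card ≤ Module.finrank ℂ (flaggedWeylModule D) := by
  choose f hf hm using hK
  have hli := linearIndependent_of_hasInitial K (fun m => f m m.2) fun m => hm m m.2
  have : LinearIndependent ℂ fun m : K => (⟨f m m.2, hf m m.2⟩ : flaggedWeylModule D) :=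
    LinearIndependent.of_comp (flaggedWeylModule D).subtype hli
  simpa using this.fintype_card_le_finrank

/-! ### Two kinds of moves performed in sets of columns -/

/-- The columns of `D` which contain row `q` but not row `p`. -/
def movableCols {n : ℕ} (D : Diagram n) (p q : Fin n) : Finset (Fin n) :=
  Finset.univ.filter fun j => (p, j) ∉ D ∧ (q, j) ∈ D

/-- Moving `e.2` to `e.1` in the columns in `J`, and `e'.2` to `e'.1` in the columns in `J'`. -/
theorem exists_mem_hasInitial_pair {n : ℕ} (D : Diagram n) (e e' : Fin n × Fin n)
    (J J' : Finset (Fin n)) (he : e.1 < e.2) (he' : e'.1 < e'.2)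
    (hJ : J ⊆ movableCols D e.1 e.2) (hJ' : J' ⊆ movableCols D e'.1 e'.2)
    (hlt : ∀ j ∈ J, j ∈ J' → e.2 < e'.1) :
    ∃ f ∈ flaggedWeylModule D,
      HasInitial f (Finsupp.single e J.card + Finsupp.single e' J'.card) := by
  obtain ⟨p, q⟩ := e
  obtain ⟨p', q'⟩ := e'
  dsimp only at *
  have hJD : ∀ j ∈ J, (p, j) ∉ D ∧ (q, j) ∈ D := fun j hj => by
    simpa [movableCols] using hJ hj
  have hJD' : ∀ j ∈ J', (p', j) ∉ D ∧ (q', j) ∈ D := fun j hj => by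
    simpa [movableCols] using hJ' hj
  -- If both moves act in column `j`, then `hlt` gives `q < p' < q'`: the branches do not compete,
  -- and the moved boxes do not jump over each other.
  let G : Fin n → Fin n → Fin n := fun j d =>
    if j ∈ J ∧ d = q then p else if j ∈ J' ∧ d = q' then p' else d
  have hmoved : ∀ j d, G j d ≠ d →
      (j ∈ J ∧ d = q ∧ G j d = p) ∨ (j ∈ J' ∧ d = q' ∧ G j d = p') := by
    intro j d h
    simp only [G] at h ⊢
    split_ifs at h ⊢ <;> grind
  have hG : ∀ j, IsMove (D.col j) (G j) := by
    intro j
    refine ⟨fun d => ?_, fun d hd h => ?_, fun d hd d' hd' hdd h h' => ?_⟩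
    · by_contra! h
      have := hmoved j d h.ne'
      grind
    · have := hmoved j d h
      simp only [Diagram.col, Finset.mem_filter, Finset.mem_univ, true_and] at hd ⊢
      grind
    · have h₁ := hmoved j d h
      have h₂ := hmoved j d' h'
      grind
  have hexp : ∑ j, moveExponent (D.col j) (G j) =
      Finsupp.single (p, q) J.card + Finsupp.single (p', q') J'.card := by
    have hcol : ∀ j, moveExponent (D.col j) (G j) =
        (if j ∈ J then Finsupp.single (p, q) 1 else 0) +
          if j ∈ J' then Finsupp.single (p', q') 1 else 0 := by
      intro j
      have hterm : ∀ d ∈ D.col j, (if G j d = d then 0 else Finsupp.single (G j d, d) 1 :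
          Fin n × Fin n →₀ ℕ) =
          (if d = q then if j ∈ J then Finsupp.single (p, q) 1 else 0 else 0) +
            if d = q' then if j ∈ J' then Finsupp.single (p', q') 1 else 0 else 0 := by
        intro d _
        simp only [G]
        by_cases h₁ : j ∈ J ∧ d = q
        · have h₂ : ¬ (j ∈ J' ∧ d = q') := fun h => by
            have := hlt j h₁.1 h.1
            have := h₁.2.symm.trans h.2
            grind
          obtain ⟨hj, rfl⟩ := h₁
          by_cases h₃ : d = q'
          · have : j ∉ J' := fun h => h₂ ⟨h, h₃⟩
            simp [hj, he.ne, this]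
          · simp [hj, he.ne, h₃]
        · by_cases h₂ : j ∈ J' ∧ d = q'
          · obtain ⟨hj, rfl⟩ := h₂
            by_cases h₃ : d = q
            · have : j ∉ J := fun h => h₁ ⟨h, h₃⟩
              simp [hj, he'.ne, this]
            · simp [hj, he'.ne, h₃]
          · rw [if_neg h₁, if_neg h₂, if_pos rfl, ← ite_and, ← ite_and, if_neg, if_neg, add_zero]
            · exact fun h => h₂ h.symm
            · exact fun h => h₁ h.symm
      rw [moveExponent, Finset.sum_congr rfl hterm, Finset.sum_add_distrib, Finset.sum_ite_eq',
        Finset.sum_ite_eq']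
      congr 1
      · by_cases h : j ∈ J
        · simp [Diagram.col, (hJD j h).2]
        · simp [h]
      · by_cases h : j ∈ J'
        · simp [Diagram.col, (hJD' j h).2]
        · simp [h]
    simp [hcol, Finset.sum_add_distrib, Finset.sum_ite_mem]
  rw [← hexp]
  exact exists_mem_hasInitial D G hG

/-! ### Ranks of columns and exponents of configurations -/

/-- The position of `j` among the elements of `J`, counted from `1`. -/
def rankIn {n : ℕ} (J : Finset (Fin n)) (j : Fin n) : ℕ :=
  (J.filter fun i => i ≤ j).card

theorem rankIn_pos {n : ℕ} {J : Finset (Fin n)} {j : Fin n} (hj : j ∈ J) : 0 < rankIn J j :=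
  Finset.card_pos.mpr ⟨j, by simp [hj]⟩

theorem rankIn_lt {n : ℕ} {J : Finset (Fin n)} {i j : Fin n} (hj : j ∈ J) (h : i < j) :
    rankIn J i < rankIn J j := by
  refine Finset.card_lt_card ((Finset.ssubset_iff_of_subset ?_).mpr ⟨j, ?_⟩)
  · intro k
    simp only [Finset.mem_filter]
    exact fun hk => ⟨hk.1, hk.2.trans h.le⟩
  · simp [hj, h]

theorem rankIn_inj {n : ℕ} {J : Finset (Fin n)} {i j : Fin n} (hi : i ∈ J) (hj : j ∈ J)
    (h : rankIn J i = rankIn J j) : i = j := by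
  rcases lt_trichotomy i j with hlt | heq | hlt
  · exact absurd h (rankIn_lt hj hlt).ne
  · exact heq
  · exact absurd h (rankIn_lt hi hlt).ne'

/-- The support on the left is `{x, y}`, so the variables agree in order or swapped. In the
applications the order of the rows excludes the swap. -/
theorem single_add_single_inj {α : Type*} {x y x' y' : α} {a b a' b' : ℕ} (hxy : x ≠ y)
    (hxy' : x' ≠ y') (ha : 0 < a) (hb : 0 < b)
    (h : Finsupp.single x a + Finsupp.single y b = Finsupp.single x' a' + Finsupp.single y' b') :
    (x = x' ∧ y = y' ∧ a = a' ∧ b = b') ∨ (x = y' ∧ y = x') := by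
  classical
  have hx := DFunLike.congr_fun h x
  have hy := DFunLike.congr_fun h y
  simp only [Finsupp.add_apply, Finsupp.single_apply] at hx hy
  grind

/-- Triples `((p, q), j)` such that row `p < q` is empty and row `q` is filled in column `j`. -/
def indexA {n : ℕ} (D : Diagram n) : Finset ((Fin n × Fin n) × Fin n) :=
  Finset.univ.filter fun x => x.1.1 < x.1.2 ∧ x.2 ∈ movableCols D x.1.1 x.1.2

/-- The exponent attached to an element of `indexA D`. -/
noncomputable def exponentA {n : ℕ} (D : Diagram n) (x : (Fin n × Fin n) × Fin n) :
    Fin n × Fin n →₀ ℕ :=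
  Finsupp.single x.1 (rankIn (movableCols D x.1.1 x.1.2) x.2)

/-- The columns meeting the rows `p`, `q`, `r` in `q`, `r` only. -/
def fullCols {n : ℕ} (D : Diagram n) (p q r : Fin n) : Finset (Fin n) :=
  Finset.univ.filter fun j => (p, j) ∉ D ∧ (q, j) ∈ D ∧ (r, j) ∈ D

/-- The columns meeting the rows `p`, `q`, `r` in `q` only. -/
def middleCols {n : ℕ} (D : Diagram n) (p q r : Fin n) : Finset (Fin n) :=
  Finset.univ.filter fun j => (p, j) ∉ D ∧ (q, j) ∈ D ∧ (r, j) ∉ D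

/-- Positions of the configurations (B) and (B'). -/
def indexB {n : ℕ} (D : Diagram n) : Finset ((Fin n × Fin n × Fin n) × Fin n × Fin n) :=
  Finset.univ.filter fun x => x.1.1 < x.1.2.1 ∧ x.1.2.1 < x.1.2.2 ∧
    x.2.1 ∈ fullCols D x.1.1 x.1.2.1 x.1.2.2 ∧ x.2.2 ∈ middleCols D x.1.1 x.1.2.1 x.1.2.2

/-- The exponent attached to an element of `indexB D`. -/
noncomputable def exponentB {n : ℕ} (D : Diagram n)
    (x : (Fin n × Fin n × Fin n) × Fin n × Fin n) : Fin n × Fin n →₀ ℕ :=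
  Finsupp.single (x.1.1, x.1.2.2) (rankIn (fullCols D x.1.1 x.1.2.1 x.1.2.2) x.2.1) +
    Finsupp.single (x.1.1, x.1.2.1) (rankIn (middleCols D x.1.1 x.1.2.1 x.1.2.2) x.2.2)

/-- Positions of the configurations (C), (C') and (C''). -/
def indexC {n : ℕ} (D : Diagram n) :
    Finset (((Fin n × Fin n) × Fin n × Fin n) × Fin n × Fin n) :=
  Finset.univ.filter fun x => x.1.1.1 < x.1.1.2 ∧ x.1.1.2 < x.1.2.1 ∧ x.1.2.1 < x.1.2.2 ∧
    x.2.1 ∈ movableCols D x.1.1.1 x.1.1.2 ∧ x.2.2 ∈ movableCols D x.1.2.1 x.1.2.2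

/-- The exponent attached to an element of `indexC D`. -/
noncomputable def exponentC {n : ℕ} (D : Diagram n)
    (x : ((Fin n × Fin n) × Fin n × Fin n) × Fin n × Fin n) : Fin n × Fin n →₀ ℕ :=
  Finsupp.single x.1.1 (rankIn (movableCols D x.1.1.1 x.1.1.2) x.2.1) +
    Finsupp.single x.1.2 (rankIn (movableCols D x.1.2.1 x.1.2.2) x.2.2)

/-! ### Configurations are counted by the index sets -/

/-- Every configuration is the box set of some index; surjectivity is enough for this bound, here
and for the other two types. -/
theorem r₁_le {n : ℕ} (D : Diagram n) : r₁ D ≤ (indexA D).card := by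
  rw [r₁, ← Set.ncard_coe_finset]
  refine (Set.ncard_le_ncard (t := (fun x : (Fin n × Fin n) × Fin n =>
    ({(x.1.1, x.2), (x.1.2, x.2)} : Diagram n)) '' (indexA D : Set _)) ?_).trans
    (Set.ncard_image_le)
  rintro E ⟨p, q, j, hpq, rfl, hE⟩
  refine ⟨((p, q), j), ?_, rfl⟩
  have h₁ := Finset.ext_iff.mp hE (p, j)
  have h₂ := Finset.ext_iff.mp hE (q, j)
  simp [hpq.ne] at h₁ h₂
  simp [indexA, movableCols, hpq, h₁, h₂]

theorem r₂_le {n : ℕ} (D : Diagram n) : r₂ D ≤ (indexB D).card := by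
  rw [r₂, ← Set.ncard_coe_finset]
  refine (Set.ncard_le_ncard (t := (fun x : (Fin n × Fin n × Fin n) × Fin n × Fin n =>
    ({x.1.1, x.1.2.1, x.1.2.2} : Finset (Fin n)) ×ˢ ({x.2.1, x.2.2} : Finset (Fin n))) ''
      (indexB D : Set _)) ?_).trans (Set.ncard_image_le)
  rintro E (⟨p, q, r, j, k, hpq, hqr, hjk, rfl, hE⟩ | ⟨p, q, r, j, k, hpq, hqr, hjk, rfl, hE⟩)
  · refine ⟨((p, q, r), (j, k)), ?_, ?_⟩
    · have h (x) := Finset.ext_iff.mp hE x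
      have h₁ := h (p, j)
      have h₂ := h (p, k)
      have h₃ := h (q, j)
      have h₄ := h (q, k)
      have h₅ := h (r, j)
      have h₆ := h (r, k)
      simp [hpq.ne, hqr.ne', (hpq.trans hqr).ne, hjk.ne'] at h₁ h₂ h₃ h₄ h₅ h₆
      simp [indexB, fullCols, middleCols, *]
    · ext ⟨a, b⟩
      simp
      tauto
  -- In (B') the full column is the right one, and the index lists the full column first.
  · refine ⟨((p, q, r), (k, j)), ?_, ?_⟩
    · have h (x) := Finset.ext_iff.mp hE x
      have h₁ := h (p, j)
      have h₂ := h (p, k)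
      have h₃ := h (q, j)
      have h₄ := h (q, k)
      have h₅ := h (r, j)
      have h₆ := h (r, k)
      simp [hpq.ne, hqr.ne', (hpq.trans hqr).ne, hjk.ne] at h₁ h₂ h₃ h₄ h₅ h₆
      simp [indexB, fullCols, middleCols, *]
    · ext ⟨a, b⟩
      simp
      tauto

theorem r₃_le {n : ℕ} (D : Diagram n) : r₃ D ≤ (indexC D).card := by
  rw [r₃, ← Set.ncard_coe_finset]
  refine (Set.ncard_le_ncard (t := (fun x : ((Fin n × Fin n) × Fin n × Fin n) × Fin n × Fin n =>
    ({(x.1.1.1, x.2.1), (x.1.1.2, x.2.1), (x.1.2.1, x.2.2), (x.1.2.2, x.2.2)} : Diagram n)) ''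
      (indexC D : Set _)) ?_).trans (Set.ncard_image_le)
  have key : ∀ p q r s j k : Fin n, p < q → q < r → r < s →
      ({(p, j), (q, j), (r, k), (s, k)} : Diagram n) ∩ D = {(q, j), (s, k)} →
      ((((p, q), (r, s)), (j, k)) : ((Fin n × Fin n) × Fin n × Fin n) × Fin n × Fin n) ∈
        indexC D := by
    intro p q r s j k hpq hqr hrs hE
    have h₁ := Finset.ext_iff.mp hE (p, j)
    have h₂ := Finset.ext_iff.mp hE (q, j)
    have h₃ := Finset.ext_iff.mp hE (r, k)
    have h₄ := Finset.ext_iff.mp hE (s, k)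
    simp [hpq.ne, hqr.ne', hrs.ne, (hpq.trans (hqr.trans hrs)).ne] at h₁ h₂ h₃ h₄
    simp [indexC, movableCols, *]
  rintro E (⟨p, q, r, s, j, k, hpq, hqr, hrs, -, rfl, hE⟩ |
    ⟨p, q, r, s, j, k, hpq, hqr, hrs, -, rfl, hE⟩ | ⟨p, q, r, s, j, hpq, hqr, hrs, rfl, hE⟩)
  · exact ⟨_, key p q r s j k hpq hqr hrs hE, rfl⟩
  · exact ⟨_, key p q r s k j hpq hqr hrs hE, rfl⟩
  · exact ⟨_, key p q r s j j hpq hqr hrs hE, rfl⟩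

/-! ### Distinctness of the exponents -/

theorem exponentA_injOn {n : ℕ} (D : Diagram n) :
    Set.InjOn (exponentA D) (indexA D : Set _) := by
  rintro ⟨⟨p, q⟩, j⟩ hx ⟨⟨p', q'⟩, j'⟩ hx' h
  simp only [indexA, Finset.coe_filter, Finset.mem_univ, true_and, Set.mem_ofPred_eq] at hx hx'
  have := rankIn_pos hx.2
  rcases (Finsupp.single_eq_single_iff _ _ _ _).mp h with ⟨h₁, h₂⟩ | ⟨h₁, -⟩
  · obtain ⟨rfl, rfl⟩ := Prod.mk.inj h₁
    rw [rankIn_inj hx.2 hx'.2 h₂]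
  · dsimp only at h₁
    omega

/-- A swap of the two variables would force `r = q' < r' = q`, against `q < r`. Once the rows agree,
the ranks determine the columns. -/
theorem exponentB_injOn {n : ℕ} (D : Diagram n) :
    Set.InjOn (exponentB D) (indexB D : Set _) := by
  rintro ⟨⟨p, q, r⟩, j, k⟩ hx ⟨⟨p', q', r'⟩, j', k'⟩ hx' h
  simp only [indexB, Finset.coe_filter, Finset.mem_univ, true_and, Set.mem_ofPred_eq] at hx hx'
  obtain ⟨hpq, hqr, hj, hk⟩ := hx
  obtain ⟨hpq', hqr', hj', hk'⟩ := hx'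
  rcases single_add_single_inj (by simp [hqr.ne']) (by simp [hqr'.ne']) (rankIn_pos hj)
    (rankIn_pos hk) h with ⟨h₁, h₂, h₃, h₄⟩ | ⟨h₁, h₂⟩
  · simp only [Prod.mk.injEq] at h₁ h₂
    obtain ⟨rfl, rfl⟩ := h₁
    obtain ⟨-, rfl⟩ := h₂
    rw [rankIn_inj hj hj' h₃, rankIn_inj hk hk' h₄]
  · simp only [Prod.mk.injEq] at h₁ h₂
    grind

theorem exponentC_injOn {n : ℕ} (D : Diagram n) :
    Set.InjOn (exponentC D) (indexC D : Set _) := by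
  rintro ⟨⟨⟨p, q⟩, r, s⟩, j, k⟩ hx ⟨⟨⟨p', q'⟩, r', s'⟩, j', k'⟩ hx' h
  simp only [indexC, Finset.coe_filter, Finset.mem_univ, true_and, Set.mem_ofPred_eq] at hx hx'
  obtain ⟨hpq, hqr, hrs, hj, hk⟩ := hx
  obtain ⟨hpq', hqr', hrs', hj', hk'⟩ := hx'
  rcases single_add_single_inj (by simp; grind) (by simp; grind) (rankIn_pos hj)
    (rankIn_pos hk) h with ⟨h₁, h₂, h₃, h₄⟩ | ⟨h₁, h₂⟩
  · simp only [Prod.mk.injEq] at h₁ h₂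
    obtain ⟨rfl, rfl⟩ := h₁
    obtain ⟨rfl, rfl⟩ := h₂
    rw [rankIn_inj hj hj' h₃, rankIn_inj hk hk' h₄]
  · simp only [Prod.mk.injEq] at h₁ h₂
    grind

theorem card_support_exponentA {n : ℕ} (D : Diagram n) {x} (hx : x ∈ indexA D) :
    (exponentA D x).support.card = 1 := by
  simp only [indexA, Finset.mem_filter, Finset.mem_univ, true_and] at hx
  rw [exponentA, Finsupp.support_single _ (rankIn_pos hx.2).ne', Finset.card_singleton]

theorem card_support_single_add_single {α : Type*} {x y : α} {a b : ℕ} (hxy : x ≠ y)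
    (ha : 0 < a) (hb : 0 < b) :
    (Finsupp.single x a + Finsupp.single y b).support.card = 2 := by
  classical
  have : (Finsupp.single x a + Finsupp.single y b).support = {x, y} := by
    ext z
    simp only [Finsupp.mem_support_iff, Finsupp.add_apply, Finsupp.single_apply,
      Finset.mem_insert, Finset.mem_singleton]
    grind
  rw [this, Finset.card_pair hxy]

theorem card_support_exponentB {n : ℕ} (D : Diagram n) {x} (hx : x ∈ indexB D) :
    (exponentB D x).support.card = 2 := by
  simp only [indexB, Finset.mem_filter, Finset.mem_univ, true_and] at hx
  exact card_support_single_add_single (by simp [hx.2.1.ne']) (rankIn_pos hx.2.2.1)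
    (rankIn_pos hx.2.2.2)

theorem card_support_exponentC {n : ℕ} (D : Diagram n) {x} (hx : x ∈ indexC D) :
    (exponentC D x).support.card = 2 := by
  simp only [indexC, Finset.mem_filter, Finset.mem_univ, true_and] at hx
  obtain ⟨hpq, hqr, hrs, hj, hk⟩ := hx
  exact card_support_single_add_single (fun h => (hpq.trans hqr).ne (congrArg Prod.fst h))
    (rankIn_pos hj) (rankIn_pos hk)

/-- The two variables share their row index in type (B), but not in type (C). -/
theorem exponentB_ne_exponentC {n : ℕ} (D : Diagram n) {x y} (hx : x ∈ indexB D)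
    (hy : y ∈ indexC D) : exponentB D x ≠ exponentC D y := by
  intro h
  obtain ⟨⟨p, q, r⟩, j, k⟩ := x
  obtain ⟨⟨⟨p', q'⟩, r', s'⟩, j', k'⟩ := y
  simp only [indexB, Finset.mem_filter, Finset.mem_univ, true_and] at hx
  simp only [indexC, Finset.mem_filter, Finset.mem_univ, true_and] at hy
  have := single_add_single_inj (by simp [hx.2.1.ne']) (by simp; grind) (rankIn_pos hx.2.2.1)
    (rankIn_pos hx.2.2.2) h
  simp only [Prod.mk.injEq] at this
  grind

/-! ### The lower bound for the dimension -/

theorem le_finrank {n : ℕ} (D : Diagram n) :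
    1 + r₁ D + r₂ D + r₃ D ≤ Module.finrank ℂ (flaggedWeylModule D) := by
  classical
  let K₀ : Finset (Fin n × Fin n →₀ ℕ) := {0}
  let K₁ := (indexA D).image (exponentA D)
  let K₂ := (indexB D).image (exponentB D)
  let K₃ := (indexC D).image (exponentC D)
  -- The four families involve 0, 1, 2 and 2 variables, so only the last two need a separate
  -- argument.
  have hsupp : ∀ {i j : ℕ} {K K' : Finset (Fin n × Fin n →₀ ℕ)},
      (∀ m ∈ K, m.support.card = i) → (∀ m ∈ K', m.support.card = j) → i ≠ j →
      Disjoint K K' := by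
    intro i j K K' h h' hij
    exact Finset.disjoint_left.mpr fun m hm hm' => hij ((h m hm).symm.trans (h' m hm'))
  have s₀ : ∀ m ∈ K₀, m.support.card = 0 := by simp [K₀]
  have s₁ : ∀ m ∈ K₁, m.support.card = 1 :=
    Finset.forall_mem_image.mpr fun x hx => card_support_exponentA D hx
  have s₂ : ∀ m ∈ K₂, m.support.card = 2 :=
    Finset.forall_mem_image.mpr fun x hx => card_support_exponentB D hx
  have s₃ : ∀ m ∈ K₃, m.support.card = 2 :=
    Finset.forall_mem_image.mpr fun x hx => card_support_exponentC D hx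
  have d₂₃ : Disjoint K₂ K₃ := by
    refine Finset.disjoint_left.mpr fun m hm hm' => ?_
    obtain ⟨x, hx, rfl⟩ := Finset.mem_image.mp hm
    obtain ⟨y, hy, h⟩ := Finset.mem_image.mp hm'
    exact exponentB_ne_exponentC D hx hy h.symm
  have hcard : (K₀ ∪ K₁ ∪ (K₂ ∪ K₃)).card =
      1 + (indexA D).card + ((indexB D).card + (indexC D).card) := by
    rw [Finset.card_union_of_disjoint, Finset.card_union_of_disjoint (hsupp s₀ s₁ (by simp)),
      Finset.card_union_of_disjoint d₂₃, Finset.card_image_of_injOn (exponentA_injOn D),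
      Finset.card_image_of_injOn (exponentB_injOn D),
      Finset.card_image_of_injOn (exponentC_injOn D), Finset.card_singleton]
    simp only [Finset.disjoint_union_left, Finset.disjoint_union_right]
    exact ⟨⟨hsupp s₀ s₂ (by simp), hsupp s₁ s₂ (by simp)⟩,
      hsupp s₀ s₃ (by simp), hsupp s₁ s₃ (by simp)⟩
  have hK := card_le_finrank D (K₀ ∪ K₁ ∪ (K₂ ∪ K₃)) ?_
  · have := r₁_le D
    have := r₂_le D
    have := r₃_le D
    omega
  · intro m hm
    simp only [Finset.mem_union] at hm
    rcases hm with (hm | hm) | hm | hm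
    · rw [Finset.mem_singleton.mp hm]
      have := exists_mem_hasInitial D (fun _ d => d) fun j =>
        ⟨fun d => le_rfl, fun d _ h => absurd rfl h, fun d _ d' _ _ h => absurd rfl h⟩
      simpa [moveExponent] using this
    · obtain ⟨⟨⟨p, q⟩, j⟩, hx, rfl⟩ := Finset.mem_image.mp hm
      simp only [indexA, Finset.mem_filter, Finset.mem_univ, true_and] at hx
      -- A single kind of move: the second one is performed in no column.
      have := exists_mem_hasInitial_pair D (p, q) (p, q)
        ((movableCols D p q).filter (· ≤ j)) ∅ hx.1 hx.1 (Finset.filter_subset _ _) (by simp)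
        (by simp)
      simpa [exponentA, rankIn] using this
    · obtain ⟨⟨⟨p, q, r⟩, j, k⟩, hx, rfl⟩ := Finset.mem_image.mp hm
      simp only [indexB, Finset.mem_filter, Finset.mem_univ, true_and] at hx
      refine exists_mem_hasInitial_pair D (p, r) (p, q)
        ((fullCols D p q r).filter (· ≤ j)) ((middleCols D p q r).filter (· ≤ k))
        (hx.1.trans hx.2.1) hx.1 ?_ ?_ ?_
      · intro i
        simp only [fullCols, movableCols, Finset.mem_filter, Finset.mem_univ, true_and]
        tauto
      · intro i
        simp only [middleCols, movableCols, Finset.mem_filter, Finset.mem_univ, true_and]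
        tauto
      -- No column is both full and middle, since they differ in row `r`; the condition on common
      -- columns is vacuous.
      · intro i
        simp only [fullCols, middleCols, Finset.mem_filter, Finset.mem_univ, true_and]
        tauto
    · obtain ⟨⟨⟨⟨p, q⟩, r, s⟩, j, k⟩, hx, rfl⟩ := Finset.mem_image.mp hm
      simp only [indexC, Finset.mem_filter, Finset.mem_univ, true_and] at hx
      exact exists_mem_hasInitial_pair D (p, q) (r, s)
        ((movableCols D p q).filter (· ≤ j)) ((movableCols D r s).filter (· ≤ k))
        hx.1 hx.2.2.1 (Finset.filter_subset _ _) (Finset.filter_subset _ _) fun _ _ _ => hx.2.1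

end FlaggedWeyl

theorem mainTheorem5 (n : ℕ) (D : FlaggedWeyl.Diagram n) :
    ((1 + FlaggedWeyl.r₁ D + FlaggedWeyl.r₂ D + FlaggedWeyl.r₃ D : ℕ) : ℂ)
      ≤ FlaggedWeyl.dualCharacter D 1 := by
  rw [FlaggedWeyl.dualCharacter_one]
  exact_mod_cast FlaggedWeyl.le_finrank D
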